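/- Let $\mathbb K\in\{\mathbb R,\mathbb C\}$, let $E$ be a normed vector space over $\mathbb K$, let $\mathbf y$ be a continuous linear functional on $E$, and let $(\mathbf S_n)_{n\ge 0}$ be a sequence in $E$. The first topological $\varepsilon$-algorithm produces $\widehat{\boldsymbol\varepsilon}_{2k}^{(n)}\in E$ and $\widehat{\boldsymbol\varepsilon}_{2k+1}^{(n)}\in E^*$ (the algebraic dual) by $\widehat{\boldsymbol\varepsilon}_{-1}^{(n)}=\mathbf 0$, $\widehat{\boldsymbol\varepsilon}_{0}^{(n)}=\mathbf S_n$ and, for $k,n\ge 0$, $$\widehat{\boldsymbol\varepsilon}_{2k+1}^{(n)}=\widehat{\boldsymbol\varepsilon}_{2k-1}^{(n+1)}+\frac{\mathbf y}{\langle \mathbf y,\Delta_k^{(n)}\rangle},\qquad \widehat{\boldsymbol\varepsilon}_{2k+2}^{(n)}=\widehat{\boldsymbol\varepsilon}_{2k}^{(n+1)}+\frac{\Delta_k^{(n)}}{\langle \widehat{\boldsymbol\varepsilon}_{2k+1}^{(n+1)}-\widehat{\boldsymbol\varepsilon}_{2k+1}^{(n)},\,\Delta_k^{(n)}\rangle},\qquad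 \Delta_k^{(n)}=\widehat{\boldsymbol\varepsilon}_{2k}^{(n+1)}-\widehat{\boldsymbol\varepsilon}_{2k}^{(n)}.$$ Let $\mathbf S\in E$, $a_i\in\mathbb K$, $\mathbf u_i\in E$ ($i\ge 1$) and real numbers $1>\lambda_1>\lambda_2>\cdots>0$ be such that, as $n\to\infty$, $$\text{a)}\quad \mathbf S_n-\mathbf S\sim\sum_{i=1}^\infty a_i\lambda_i^n\mathbf u_i\qquad\text{or}\qquad \text{b)}\quad \mathbf S_n-\mathbf S\sim(-1)^n\sum_{i=1}^\infty a_i\lambda_i^n\mathbf u_i,$$ in the sense of asymptotic expansions: for every $p\ge 1$, the difference between $\mathbf S_n-\mathbf S$ and the partial sum over $i\le p$ (multiplied by $(-1)^n$ in case b)) is $o(\lambda_p^n)$. Fix $k\ge 0$ and suppose that $a_i\ne 0$ and $\langle\mathbf y,\mathbf u_i\rangle\neq 0$ for $1\le i\le k$. Then, for all sufficiently large $n$, no denominator vanishes in the computation of the entries with lower index at most $2k$ and upper index at least $n$ (so that $\widehat{\boldsymbol\varepsilon}_{2k}^{(n)}$ is defined), and $$\widehat{\boldsymbol\varepsilon}_{2k}^{(n)}-\mathbf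 S=\mathcal O(\lambda_{k+1}^n)\qquad(n\to\infty).$$ If moreover $a_{k+1}\neq0$ and $\langle\mathbf y,\mathbf u_{k+1}\rangle\ne 0$, then for all sufficiently large $n$ the entry $\widehat{\boldsymbol\varepsilon}_{2k+2}^{(n)}$ is defined in the same sense, $\widehat{\boldsymbol\varepsilon}_{2k}^{(n)}\neq\mathbf S$, and $$\frac{\|\widehat{\boldsymbol\varepsilon}_{2k+2}^{(n)}-\mathbf S\|}{\|\widehat{\boldsymbol\varepsilon}_{2k}^{(n)}-\mathbf S\|}=\mathcal O\!\left(\Big(\frac{\lambda_{k+2}}{\lambda_{k+1}}\Big)^{n}\right)\qquad(n\to\infty).$$ -/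

import Mathlib

open Filter Asymptotics

/-- Two consecutive columns of the array of the first topological epsilon-algorithm applied to the
sequence `S` of elements of `E` with the linear functional `y`: the value at `k` is the pair
`(ε̂_{2k-1}, ε̂_{2k})`, each column being a function of the upper index `n`. -/
noncomputable def tea1Columns {𝕜 E : Type*} [Field 𝕜] [AddCommGroup E] [Module 𝕜 E]
    (y : Module.Dual 𝕜 E) (S : ℕ → E) : ℕ → (ℕ → Module.Dual 𝕜 E) × (ℕ → E)
  | 0 => (fun _ => 0, S)
  | k + 1 =>
    let prevOdd := (tea1Columns y S k).1
    let even := (tea1Columns y S k).2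
    let odd : ℕ → Module.Dual 𝕜 E := fun n =>
      prevOdd (n + 1) + (y (even (n + 1) - even n))⁻¹ • y
    (odd, fun n => even (n + 1) +
      ((odd (n + 1) - odd n) (even (n + 1) - even n))⁻¹ • (even (n + 1) - even n))

/-- The element `ε̂_{2k}^{(n)}` of `E`. -/
noncomputable def epsHatEven {𝕜 E : Type*} [Field 𝕜] [AddCommGroup E] [Module 𝕜 E]
    (y : Module.Dual 𝕜 E) (S : ℕ → E) (k n : ℕ) : E :=
  (tea1Columns y S k).2 n

/-- The element `ε̂_{2k+1}^{(n)}` of the algebraic dual of `E`. -/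
noncomputable def epsHatOdd {𝕜 E : Type*} [Field 𝕜] [AddCommGroup E] [Module 𝕜 E]
    (y : Module.Dual 𝕜 E) (S : ℕ → E) (k n : ℕ) : Module.Dual 𝕜 E :=
  (tea1Columns y S (k + 1)).1 n

theorem epsHatEven_zero {𝕜 E : Type*} [Field 𝕜] [AddCommGroup E] [Module 𝕜 E]
    (y : Module.Dual 𝕜 E) (S : ℕ → E) (n : ℕ) : epsHatEven y S 0 n = S n := rfl

theorem epsHatOdd_zero {𝕜 E : Type*} [Field 𝕜] [AddCommGroup E] [Module 𝕜 E]
    (y : Module.Dual 𝕜 E) (S : ℕ → E) (n : ℕ) :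
    epsHatOdd y S 0 n = 0 + (y (epsHatEven y S 0 (n + 1) - epsHatEven y S 0 n))⁻¹ • y := rfl

theorem epsHatOdd_succ {𝕜 E : Type*} [Field 𝕜] [AddCommGroup E] [Module 𝕜 E]
    (y : Module.Dual 𝕜 E) (S : ℕ → E) (k n : ℕ) :
    epsHatOdd y S (k + 1) n = epsHatOdd y S k (n + 1) +
      (y (epsHatEven y S (k + 1) (n + 1) - epsHatEven y S (k + 1) n))⁻¹ • y := rfl

theorem epsHatEven_succ {𝕜 E : Type*} [Field 𝕜] [AddCommGroup E] [Module 𝕜 E]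
    (y : Module.Dual 𝕜 E) (S : ℕ → E) (k n : ℕ) :
    epsHatEven y S (k + 1) n = epsHatEven y S k (n + 1) +
      ((epsHatOdd y S k (n + 1) - epsHatOdd y S k n)
        (epsHatEven y S k (n + 1) - epsHatEven y S k n))⁻¹ •
        (epsHatEven y S k (n + 1) - epsHatEven y S k n) := rfl

/-- The two divisions that lead from the columns with lower index at most `2k` to the entries
`ε̂_{2k+1}^{(n)}` and `ε̂_{2k+2}^{(n)}` have nonzero denominators. -/
def TEA1Step {𝕜 E : Type*} [Field 𝕜] [AddCommGroup E] [Module 𝕜 E]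
    (y : Module.Dual 𝕜 E) (S : ℕ → E) (k n : ℕ) : Prop :=
  y (epsHatEven y S k (n + 1) - epsHatEven y S k n) ≠ 0 ∧
    (epsHatOdd y S k (n + 1) - epsHatOdd y S k n)
      (epsHatEven y S k (n + 1) - epsHatEven y S k n) ≠ 0

/-- The (Poincaré) asymptotic expansion `f n ~ ∑ i, a i * φ i n • u i` as `n → ∞`, with respect
to the scale `φ 0, φ 1, …`: each partial sum approximates `f` up to an error that is negligible
with respect to the last scale function used. -/
def HasAsymptoticExpansion {𝕜 E : Type*} [NormedField 𝕜] [NormedAddCommGroup E] [NormedSpace 𝕜 E]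
    (f : ℕ → E) (φ : ℕ → ℕ → 𝕜) (a : ℕ → 𝕜) (u : ℕ → E) : Prop :=
  ∀ p : ℕ, (fun n => f n - ∑ i ∈ Finset.range (p + 1), (a i * φ i n) • u i) =o[atTop] φ p

/-!
The even entries are `ε̂_{2k}^{(n)} = ∑ j, P_j s_{n+j}`, where `P = ∑ j, P_j X ^ j` is the formal
orthogonal polynomial of degree at most `k`, normalised by `P(1) = 1`, of the functional
`X ^ i ↦ y (s_{n+i+1} - s_{n+i})`; the odd entries are `ε̂_{2k+1}^{(n)} = T(1) • y`, where `T` is the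
polynomial of degree at most `k` representing the evaluation at `1` for that functional (its
reproducing kernel). Both recurrences of the algorithm are relations between neighbouring polynomials
of the two families: `X P^{(n+1)} - P^{(n)}` is a multiple of `(X - 1) T`, and differences of kernels
are multiples of orthogonal polynomials (`exists_isKernelAtOne_succ`,
`isAnnihilator_succ_of_isKernelAtOne`, `tea1Columns_eq`). All that is needed for this, and for the
denominators to be nonzero, is that no nonzero orthogonal polynomial vanishes at `0` or at `1`.

The asymptotic part starts from one observation. A polynomial `P` in the shift multiplies the
exponential with node `Λ l` by `P(Λ l)`. Testing the orthogonality of `P` against the polynomial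
vanishing at the nodes `Λ j`, `j < k`, `j ≠ l`, gives `P(Λ l) = O((Λ k / Λ l) ^ n)`, relative to the
size of the coefficients of `P` (`eventually_norm_eval_mul_le`). By Lagrange interpolation `P` is
then controlled by its value at any other point (`eventually_coeffNorm_le`). With the points `0` and
`1` this is the regularity required above; with the point `1` it bounds the coefficients of the
normalised `P`, so that the error is `O(Λ k ^ n)` (`exists_norm_shiftEval_sub_le`); with the point
`Λ k` it bounds `P(Λ k)` from below, which yields the lower bound for the error
(`exists_le_norm_shiftEval_sub`) and thus the bound on the ratio.
-/

open Polynomial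

/-! ### Polynomials in the shift operator -/

/-- The polynomial `p` in the shift operator, applied to the sequence `f`; its value at `n` is
`∑ j, p.coeff j • f (n + j)`. -/
noncomputable def shiftEval {𝕜 E : Type*} [Field 𝕜] [AddCommGroup E] [Module 𝕜 E]
    (p : 𝕜[X]) (f : ℕ → E) : ℕ → E :=
  aeval (LinearMap.funLeft 𝕜 E (fun n : ℕ => n + 1)) p f

section Shift

variable {𝕜 E : Type*} [Field 𝕜] [AddCommGroup E] [Module 𝕜 E]

theorem shiftEval_mul (p q : 𝕜[X]) (f : ℕ → E) :
    shiftEval (p * q) f = shiftEval p (shiftEval q f) := by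
  simp [shiftEval]

theorem shiftEval_comm (p q : 𝕜[X]) (f : ℕ → E) :
    shiftEval p (shiftEval q f) = shiftEval q (shiftEval p f) := by
  rw [← shiftEval_mul, mul_comm, shiftEval_mul]

theorem shiftEval_add (p q : 𝕜[X]) (f : ℕ → E) (n : ℕ) :
    shiftEval (p + q) f n = shiftEval p f n + shiftEval q f n := by
  simp [shiftEval]

theorem shiftEval_sub (p q : 𝕜[X]) (f : ℕ → E) (n : ℕ) :
    shiftEval (p - q) f n = shiftEval p f n - shiftEval q f n := by
  simp [shiftEval]

theorem shiftEval_C_mul (c : 𝕜) (p : 𝕜[X]) (f : ℕ → E) (n : ℕ) :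
    shiftEval (C c * p) f n = c • shiftEval p f n := by
  simp [shiftEval]

theorem shiftEval_one (f : ℕ → E) (n : ℕ) : shiftEval (1 : 𝕜[X]) f n = f n := by
  simp [shiftEval]

theorem shiftEval_zero (f : ℕ → E) (n : ℕ) : shiftEval (0 : 𝕜[X]) f n = 0 := by
  simp [shiftEval]

theorem shiftEval_X_mul (p : 𝕜[X]) (f : ℕ → E) (n : ℕ) :
    shiftEval (X * p) f n = shiftEval p f (n + 1) := by
  simp [shiftEval, LinearMap.funLeft_apply]

theorem shiftEval_X_sub_one (f : ℕ → E) (n : ℕ) :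
    shiftEval (X - 1 : 𝕜[X]) f n = f (n + 1) - f n := by
  simp [shiftEval, LinearMap.funLeft_apply]

theorem shiftEval_fun_add (p : 𝕜[X]) (f g : ℕ → E) (n : ℕ) :
    shiftEval p (fun i => f i + g i) n = shiftEval p f n + shiftEval p g n :=
  congrFun (map_add (aeval (LinearMap.funLeft 𝕜 E (fun n : ℕ => n + 1)) p) f g) n

theorem shiftEval_fun_sum {ι : Type*} (p : 𝕜[X]) (t : Finset ι) (f : ι → ℕ → E) (n : ℕ) :
    shiftEval p (fun i => ∑ j ∈ t, f j i) n = ∑ j ∈ t, shiftEval p (f j) n := by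
  have h := congrFun (map_sum (aeval (LinearMap.funLeft 𝕜 E (fun n : ℕ => n + 1)) p) f t) n
  rw [Finset.sum_apply] at h
  rw [← Finset.sum_fn t f]
  exact h

theorem shiftEval_eq_sum_range {d : ℕ} {p : 𝕜[X]} (hp : p.degree ≤ d) (f : ℕ → E) (n : ℕ) :
    shiftEval p f n = ∑ j ∈ Finset.range (d + 1), p.coeff j • f (n + j) := by
  have hpow : ∀ j n, ((LinearMap.funLeft 𝕜 E (fun n : ℕ => n + 1)) ^ j) f n = f (n + j) := by
    intro j
    induction j with
    | zero => intro n; simp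
    | succ j ih =>
      intro n
      rw [pow_succ', Module.End.mul_apply, LinearMap.funLeft_apply, ih]
      congr 1; omega
  rw [shiftEval, aeval_eq_sum_range' (Nat.lt_succ_of_le (natDegree_le_iff_degree_le.2 hp)),
    LinearMap.sum_apply, Finset.sum_apply]
  simp [hpow]

/-- Geometric sequences are eigenvectors of the shift. -/
theorem shiftEval_pow_smul (p : 𝕜[X]) (z : 𝕜) (v : E) (n : ℕ) :
    shiftEval p (fun i => z ^ i • v) n = (z ^ n * p.eval z) • v := by
  rw [shiftEval_eq_sum_range degree_le_natDegree, eval_eq_sum_range, Finset.mul_sum,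
    Finset.sum_smul]
  refine Finset.sum_congr rfl fun j _ => ?_
  rw [smul_smul]
  congr 1; ring

theorem shiftEval_const (p : 𝕜[X]) (v : E) (n : ℕ) :
    shiftEval p (fun _ => v) n = p.eval 1 • v := by
  simpa using shiftEval_pow_smul p 1 v n

theorem shiftEval_map {F : Type*} [AddCommGroup F] [Module 𝕜 F] (y : E →ₗ[𝕜] F) (p : 𝕜[X])
    (f : ℕ → E) (n : ℕ) : y (shiftEval p f n) = shiftEval p (fun i => y (f i)) n := by
  simp only [shiftEval_eq_sum_range degree_le_natDegree, map_sum, map_smul]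

end Shift

/-! ### The polynomials behind the two kinds of entries -/

/-- `P` has degree at most `k` and the sequence obtained from `m` by the operator `P` vanishes at
`n, …, n + k - 1`. With `x ^ i ↦ m i` as a linear functional, `P` is the `k`-th (formal) orthogonal
polynomial of its `n`-th shift, up to a factor. -/
def IsAnnihilator {𝕜 : Type*} [Field 𝕜] (m : ℕ → 𝕜) (k n : ℕ) (P : 𝕜[X]) : Prop :=
  P.degree ≤ k ∧ ∀ i < k, shiftEval P m (n + i) = 0

/-- `T` has degree less than `k` and the sequence obtained from `m` by the operator `T` is `1` at
`n, …, n + k - 1`. In the language of orthogonal polynomials, `T` is the reproducing kernel at the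
point `1`. -/
def IsKernelAtOne {𝕜 : Type*} [Field 𝕜] (m : ℕ → 𝕜) (k n : ℕ) (T : 𝕜[X]) : Prop :=
  T.degree < k ∧ ∀ i < k, shiftEval T m (n + i) = 1

/-- A nonzero annihilator vanishes neither at `0` nor at `1`. This replaces the non-vanishing of
the two Hankel determinants of order `k` with entries `m (n + 1 + i + j)` and
`m (n + 1 + i + j) - m (n + i + j)`. -/
def IsRegularAt {𝕜 : Type*} [Field 𝕜] (m : ℕ → 𝕜) (k n : ℕ) : Prop :=
  ∀ P, IsAnnihilator m k n P → P.eval 0 = 0 ∨ P.eval 1 = 0 → P = 0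

section Algebra

variable {𝕜 : Type*} [Field 𝕜] {m : ℕ → 𝕜} {k n : ℕ}

theorem IsAnnihilator.sub {P Q : 𝕜[X]} (hP : IsAnnihilator m k n P)
    (hQ : IsAnnihilator m k n Q) : IsAnnihilator m k n (P - Q) :=
  ⟨(degree_sub_le _ _).trans (max_le hP.1 hQ.1), fun i hi => by
    rw [shiftEval_sub, hP.2 i hi, hQ.2 i hi, sub_zero]⟩

theorem degree_C_mul_le_degree (c : 𝕜) (P : 𝕜[X]) : (C c * P).degree ≤ P.degree := by
  rw [← smul_eq_C_mul]
  exact degree_smul_le c P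

theorem degree_le_of_lt_succ {P : 𝕜[X]} (hP : P.degree < ((k + 1 : ℕ) : WithBot ℕ)) :
    P.degree ≤ k :=
  (degree_le_iff_coeff_zero _ _).2 fun j hj =>
    (degree_lt_iff_coeff_zero _ _).1 hP j (by exact_mod_cast hj)

theorem IsAnnihilator.C_mul {P : 𝕜[X]} (hP : IsAnnihilator m k n P) (c : 𝕜) :
    IsAnnihilator m k n (C c * P) :=
  ⟨(degree_C_mul_le_degree c P).trans hP.1, fun i hi => by
    rw [shiftEval_C_mul, hP.2 i hi, smul_zero]⟩

theorem degree_X_mul_le {P : 𝕜[X]} (hP : P.degree ≤ k) :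
    (X * P).degree ≤ ((k + 1 : ℕ) : WithBot ℕ) := by
  rw [degree_mul, degree_X, add_comm]
  push_cast
  gcongr

/-- If the last of the required orthogonality conditions holds too, the order goes up by one. -/
theorem isAnnihilator_succ {P : 𝕜[X]} (hd : P.degree ≤ ((k + 1 : ℕ) : WithBot ℕ))
    (h : ∀ i < k, shiftEval P m (n + i) = 0) (hk : shiftEval P m (n + k) = 0) :
    IsAnnihilator m (k + 1) n P :=
  ⟨hd, fun i hi => (Nat.lt_succ_iff_lt_or_eq.1 hi).elim (h i) fun h => h ▸ hk⟩

/-- Where `m` is regular, an annihilator is determined by its value at `1`. -/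
theorem IsRegularAt.eq_C_mul (hreg : IsRegularAt m k n) {P Q : 𝕜[X]} (hP : IsAnnihilator m k n P)
    (hP1 : P.eval 1 = 1) (hQ : IsAnnihilator m k n Q) : Q = C (Q.eval 1) * P := by
  refine sub_eq_zero.1 (hreg _ (hQ.sub (hP.C_mul _)) (Or.inr ?_))
  simp [hP1]

theorem IsRegularAt.eval_zero_ne_zero (hreg : IsRegularAt m k n) {P : 𝕜[X]}
    (hP : IsAnnihilator m k n P) (hP1 : P.eval 1 = 1) : P.eval 0 ≠ 0 := fun h => by
  simp [hreg P hP (Or.inl h)] at hP1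

/-- The step to the odd column. The new kernel is `(X * P₁ - P₀) / (D * (X - 1))`, and its value at
`1` exceeds that of the old kernel by `1 / D`. -/
theorem exists_isKernelAtOne_succ (hn : 1 ≤ n) (hreg : IsRegularAt m k n)
    (hreg' : IsRegularAt m (k + 1) (n - 1)) {P₀ P₁ T : 𝕜[X]}
    (hP₀ : IsAnnihilator m k n P₀) (h₀ : P₀.eval 1 = 1)
    (hP₁ : IsAnnihilator m k (n + 1) P₁) (h₁ : P₁.eval 1 = 1) (hT : IsKernelAtOne m k (n + 1) T)
    {D : 𝕜} (hD : ∀ R, X * P₁ - P₀ = (X - 1) * R → D = shiftEval R m n) :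
    ∃ T', IsKernelAtOne m (k + 1) n T' ∧ D ≠ 0 ∧ X * P₁ - P₀ = C D * ((X - 1) * T') ∧
      T'.eval 1 = T.eval 1 + D⁻¹ := by
  have hP00 := hreg.eval_zero_ne_zero hP₀ h₀
  obtain ⟨R, hR⟩ : (X - 1) ∣ X * P₁ - P₀ := by
    have : (X - C 1) ∣ X * P₁ - P₀ := by rw [dvd_iff_isRoot]; simp [h₀, h₁]
    simpa using this
  have hDR := hD R hR
  have hQd : (X * P₁ - P₀).degree ≤ ((k + 1 : ℕ) : WithBot ℕ) :=
    (degree_sub_le _ _).trans (max_le (degree_X_mul_le hP₁.1)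
      (hP₀.1.trans (by exact_mod_cast Nat.le_succ k)))
  have hRd : R.degree ≤ k := by
    have h1 : (X - 1 : 𝕜[X]).degree = 1 := by simpa using degree_X_sub_C (1 : 𝕜)
    rw [hR, degree_mul, h1, add_comm] at hQd
    push_cast at hQd
    exact (WithBot.add_le_add_iff_right (by decide)).1 hQd
  -- The sequence `R m` is constant on `n, …, n + k`, since `(X - 1) * R` annihilates `m` there.
  have hconst : ∀ i ≤ k, shiftEval R m (n + i) = D := by
    intro i
    induction i with
    | zero => intro _; exact hDR.symm
    | succ i ih =>
      intro hi
      have h := congrArg (fun p => shiftEval p m (n + i)) hR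
      simp only [shiftEval_sub, shiftEval_X_mul, hP₀.2 i hi, sub_mul, one_mul] at h
      rw [show n + i + 1 = n + 1 + i by omega, hP₁.2 i hi, sub_zero, ih (by omega)] at h
      rw [show n + (i + 1) = n + 1 + i by omega]
      exact (sub_eq_zero.1 h.symm)
  have hD0 : D ≠ 0 := by
    intro h0
    have hXR : X * R = 0 := by
      refine hreg' _ ⟨degree_X_mul_le hRd, fun i hi => ?_⟩ (Or.inl (by simp))
      rw [shiftEval_X_mul, show n - 1 + i + 1 = n + i by omega, hconst i (by omega), h0]
    have hR0 : R = 0 := by simpa using hXR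
    have := congrArg (eval 0) hR
    simp [hR0] at this
    exact hP00 this
  have hT' : IsKernelAtOne m (k + 1) n (C D⁻¹ * R) := by
    refine ⟨((degree_C_mul_le_degree _ _).trans hRd).trans_lt (by exact_mod_cast Nat.lt_succ_self k),
      fun i hi => ?_⟩
    rw [shiftEval_C_mul, hconst i (by omega), smul_eq_mul, inv_mul_cancel₀ hD0]
  have hQ : X * P₁ - P₀ = C D * ((X - 1) * (C D⁻¹ * R)) := by
    rw [hR, mul_left_comm (X - 1), ← mul_assoc (C D), ← C_mul, mul_inv_cancel₀ hD0, C_1, one_mul]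
  refine ⟨C D⁻¹ * R, hT', hD0, hQ, ?_⟩
  have hXT : (X * T).degree ≤ (k : WithBot ℕ) := by
    rcases k with _ | k
    · have : T = 0 := by simpa using hT.1
      simp [this]
    · exact degree_X_mul_le (degree_le_of_lt_succ hT.1)
  have hann : IsAnnihilator m k n (C D⁻¹ * R - X * T) := by
    refine ⟨(degree_sub_le _ _).trans (max_le ((degree_C_mul_le_degree _ _).trans hRd) hXT),
      fun i hi => ?_⟩
    rw [shiftEval_sub, shiftEval_X_mul, hT'.2 i (by omega), show n + i + 1 = n + 1 + i by omega,
      hT.2 i hi, sub_self]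
  -- The difference of the kernels is a multiple of `P₀`; evaluation at `0` gives the factor.
  have hmul := congrArg (eval 0) (hreg.eq_C_mul hP₀ h₀ hann)
  have hQ0 := congrArg (eval 0) hR
  simp only [eval_sub, eval_mul, eval_C, eval_X, eval_one, zero_mul, sub_zero, zero_sub,
    neg_mul, one_mul, neg_inj] at hmul hQ0
  rw [← hQ0] at hmul
  have hmul := mul_right_cancel₀ hP00 hmul
  simp only [eval_mul, eval_C]
  linear_combination -hmul

/-- The step to the even column. The difference `κ` of two consecutive kernels at `1` has the
property that `(1 + κ * D) * h₁ = h₀`, where `h₀` and `h₁` are the first values of the annihilated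
sequences that are not required to vanish; so the new combination has one more vanishing value. -/
theorem isAnnihilator_succ_of_isKernelAtOne (hreg : IsRegularAt m k n)
    (hreg₁ : IsRegularAt m k (n + 1)) (hreg' : IsRegularAt m (k + 1) n) {P₀ P₁ T₀ T₁ : 𝕜[X]}
    (hP₀ : IsAnnihilator m k n P₀) (h₀ : P₀.eval 1 = 1)
    (hP₁ : IsAnnihilator m k (n + 1) P₁) (h₁ : P₁.eval 1 = 1)
    (hT₀ : IsKernelAtOne m (k + 1) n T₀) (hT₁ : IsKernelAtOne m (k + 1) (n + 1) T₁)
    {D : 𝕜} (hQ : X * P₁ - P₀ = C D * ((X - 1) * T₀)) :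
    (T₁.eval 1 - T₀.eval 1) * D ≠ 0 ∧
      IsAnnihilator m (k + 1) n
        (X * P₁ + C ((T₁.eval 1 - T₀.eval 1) * D)⁻¹ * (X * P₁ - P₀)) := by
  set κ := T₁.eval 1 - T₀.eval 1 with hκ
  have hTd : IsAnnihilator m k (n + 1) (T₁ - T₀) := by
    refine ⟨(degree_sub_le _ _).trans (max_le (degree_le_of_lt_succ hT₁.1)
      (degree_le_of_lt_succ hT₀.1)), fun i hi => ?_⟩
    rw [shiftEval_sub, hT₁.2 i (by omega), show n + 1 + i = n + (i + 1) by omega,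
      hT₀.2 (i + 1) (by omega), sub_self]
  have hTP : T₁ - T₀ = C κ * P₁ := by simpa [hκ] using hreg₁.eq_C_mul hP₁ h₁ hTd
  have e1 := congrArg (fun p => shiftEval p m (n + 1 + k)) hTP
  simp only [shiftEval_sub, shiftEval_C_mul, hT₁.2 k (by omega), smul_eq_mul] at e1
  have e2 := congrArg (fun p => shiftEval p m (n + k)) hQ
  simp only [shiftEval_sub, shiftEval_C_mul, shiftEval_X_mul, sub_mul, one_mul,
    hT₀.2 k (by omega), smul_eq_mul] at e2
  rw [show n + k + 1 = n + 1 + k by omega] at e2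
  have hXP : ∀ i < k, shiftEval (X * P₁) m (n + i) = 0 := fun i hi => by
    rw [shiftEval_X_mul, show n + i + 1 = n + 1 + i by omega, hP₁.2 i hi]
  have hXPk : shiftEval (X * P₁) m (n + k) = shiftEval P₁ m (n + 1 + k) := by
    rw [shiftEval_X_mul, show n + k + 1 = n + 1 + k by omega]
  have hXPd := degree_X_mul_le hP₁.1
  have hQd : (X * P₁ - P₀).degree ≤ ((k + 1 : ℕ) : WithBot ℕ) :=
    (degree_sub_le _ _).trans (max_le hXPd (hP₀.1.trans (by exact_mod_cast Nat.le_succ k)))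
  have hQi : ∀ i < k, shiftEval (X * P₁ - P₀) m (n + i) = 0 := fun i hi => by
    rw [shiftEval_sub, hXP i hi, hP₀.2 i hi, sub_zero]
  have hQk : shiftEval (X * P₁ - P₀) m (n + k) = -(κ * D) * shiftEval P₁ m (n + 1 + k) := by
    rw [shiftEval_sub, hXPk]
    linear_combination e2 - D * e1
  have hne : κ * D ≠ 0 := by
    intro h
    have hQ0 := hreg' _ (isAnnihilator_succ hQd hQi (by rw [hQk, h]; simp))
      (Or.inr (by simp [h₀, h₁]))
    have := congrArg (eval 0) hQ0
    simp at this
    exact hreg.eval_zero_ne_zero hP₀ h₀ this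
  refine ⟨hne, isAnnihilator_succ ?_ (fun i hi => ?_) ?_⟩
  · exact (degree_add_le _ _).trans (max_le hXPd ((degree_C_mul_le_degree _ _).trans hQd))
  · rw [shiftEval_add, shiftEval_C_mul, hXP i hi, hQi i hi, smul_zero, add_zero]
  · rw [shiftEval_add, shiftEval_C_mul, hXPk, hQk, smul_eq_mul]
    linear_combination -shiftEval P₁ m (n + 1 + k) * inv_mul_cancel₀ hne

end Algebra

/-! ### The array in closed form -/

/-- As long as the orthogonal polynomials stay regular, no denominator vanishes, the entry
`ε̂_{2j}^{(n)}` is obtained from the annihilator normalised at `1`, and `ε̂_{2j-1}^{(n)}` is the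
multiple of `y` by the value of the kernel at `1`. -/
theorem tea1Columns_eq {𝕜 E : Type*} [Field 𝕜] [AddCommGroup E] [Module 𝕜 E]
    (y : Module.Dual 𝕜 E) (s : ℕ → E) {N k : ℕ}
    (hreg : ∀ j ≤ k, ∀ n ≥ N, IsRegularAt (fun n => y (s (n + 1) - s n)) j n) :
    ∀ j ≤ k, ∀ n ≥ N + 1, (∀ i < j, TEA1Step y s i n) ∧
      (∃ P, IsAnnihilator (fun n => y (s (n + 1) - s n)) j n P ∧ P.eval 1 = 1 ∧
        (tea1Columns y s j).2 n = shiftEval P s n) ∧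
      ∃ T, IsKernelAtOne (fun n => y (s (n + 1) - s n)) j n T ∧
        (tea1Columns y s j).1 n = T.eval 1 • y := by
  set m : ℕ → 𝕜 := fun n => y (s (n + 1) - s n) with hm
  intro j
  induction j with
  | zero =>
    intro _ n _
    refine ⟨by simp, ⟨1, ⟨by simp, by simp⟩, by simp, ?_⟩,
      0, ⟨by simp, by simp⟩, ?_⟩
    · rw [shiftEval_one]; rfl
    · simp [tea1Columns]
  | succ j ih =>
    intro hj
    have ih := ih (by omega)
    -- The two steps need the two neighbouring entries `n` and `n + 1` of the preceding column.
    have hodd : ∀ n ≥ N + 1, ∃ P₀ P₁ T D, IsAnnihilator m j n P₀ ∧ P₀.eval 1 = 1 ∧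
        IsAnnihilator m j (n + 1) P₁ ∧ P₁.eval 1 = 1 ∧ IsKernelAtOne m (j + 1) n T ∧ D ≠ 0 ∧
        X * P₁ - P₀ = C D * ((X - 1) * T) ∧
        epsHatEven y s j n = shiftEval P₀ s n ∧
        epsHatEven y s j (n + 1) = shiftEval P₁ s (n + 1) ∧
        y (epsHatEven y s j (n + 1) - epsHatEven y s j n) = D ∧
        epsHatOdd y s j n = T.eval 1 • y := by
      intro n hn
      obtain ⟨-, ⟨P₀, hP₀, h₀, e₀⟩, -⟩ := ih n hn
      obtain ⟨-, ⟨P₁, hP₁, h₁, e₁⟩, T, hT, eT⟩ := ih (n + 1) (by omega)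
      have hD : ∀ R, X * P₁ - P₀ = (X - 1) * R →
          y (epsHatEven y s j (n + 1) - epsHatEven y s j n) = shiftEval R m n := by
        intro R hR
        have hmX : m = shiftEval (X - 1 : 𝕜[X]) (fun i => y (s i)) := by
          funext i; rw [shiftEval_X_sub_one, hm]; simp
        rw [epsHatEven, epsHatEven, e₀, e₁, ← shiftEval_X_mul, ← shiftEval_sub, hR,
          shiftEval_map, hmX, ← shiftEval_mul, mul_comm]
      obtain ⟨T', hT', hD0, hQ, hval⟩ := exists_isKernelAtOne_succ (n := n) (m := m) (by omega)
        (hreg j (by omega) n (by omega)) (hreg (j + 1) hj (n - 1) (by omega)) hP₀ h₀ hP₁ h₁ hT hD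
      refine ⟨P₀, P₁, T', _, hP₀, h₀, hP₁, h₁, hT', hD0, hQ, e₀, e₁, rfl, ?_⟩
      rw [hval, add_smul, ← eT]
      rfl
    intro n hn
    obtain ⟨P₀, P₁, T₀, D, hP₀, h₀, hP₁, h₁, hT₀, hD0, hQ, e₀, e₁, hD, eT₀⟩ := hodd n hn
    obtain ⟨-, -, T₁, -, -, -, -, -, hT₁, -, -, -, -, -, eT₁⟩ := hodd (n + 1) (by omega)
    obtain ⟨hne, hann⟩ := isAnnihilator_succ_of_isKernelAtOne (hreg j (by omega) n (by omega))
      (hreg j (by omega) (n + 1) (by omega)) (hreg (j + 1) hj n (by omega)) hP₀ h₀ hP₁ h₁ hT₀ hT₁ hQ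
    have hden : (epsHatOdd y s j (n + 1) - epsHatOdd y s j n)
        (epsHatEven y s j (n + 1) - epsHatEven y s j n) = (T₁.eval 1 - T₀.eval 1) * D := by
      rw [eT₀, eT₁, LinearMap.sub_apply, LinearMap.smul_apply, LinearMap.smul_apply, hD,
        smul_eq_mul, smul_eq_mul, sub_mul]
    refine ⟨fun i hi => ?_, ⟨_, hann, by simp [h₀, h₁], ?_⟩, T₀, hT₀, eT₀⟩
    · rcases Nat.lt_succ_iff_lt_or_eq.1 hi with h | rfl
      · exact (ih n hn).1 i h
      · exact ⟨hD ▸ hD0, hden ▸ hne⟩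
    · change epsHatEven y s (j + 1) n = _
      rw [epsHatEven_succ, hden, e₀, e₁, shiftEval_add, shiftEval_C_mul, shiftEval_sub,
        shiftEval_X_mul]

/-! ### Estimates for polynomials in the shift -/

/-- The sum of the norms of the coefficients of `p` up to degree `d`. -/
def coeffNorm {𝕜 : Type*} [NormedField 𝕜] (d : ℕ) (p : 𝕜[X]) : ℝ :=
  ∑ j ∈ Finset.range (d + 1), ‖p.coeff j‖

section Estimates

variable {𝕜 E : Type*} [NormedField 𝕜] [NormedAddCommGroup E] [NormedSpace 𝕜 E]

theorem coeffNorm_nonneg (d : ℕ) (p : 𝕜[X]) : 0 ≤ coeffNorm d p :=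
  Finset.sum_nonneg fun _ _ => norm_nonneg _

theorem eq_zero_of_coeffNorm_nonpos {d : ℕ} {p : 𝕜[X]} (hp : p.degree ≤ d)
    (h : coeffNorm d p ≤ 0) : p = 0 := by
  have h0 := (Finset.sum_eq_zero_iff_of_nonneg fun _ _ => norm_nonneg _).1
    (le_antisymm h (coeffNorm_nonneg d p))
  ext j
  by_cases hj : j ≤ d
  · simpa using h0 j (Finset.mem_range.2 (by omega))
  · rw [(degree_le_iff_coeff_zero _ _).1 hp j (by exact_mod_cast not_le.1 hj), coeff_zero]

theorem norm_eval_one_le_coeffNorm {d : ℕ} {p : 𝕜[X]} (hp : p.degree ≤ d) :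
    ‖p.eval 1‖ ≤ coeffNorm d p := by
  rw [eval_eq_sum_range' (Nat.lt_succ_of_le (natDegree_le_iff_degree_le.2 hp))]
  exact (norm_sum_le _ _).trans_eq (by simp [coeffNorm])

theorem eventually_norm_shiftEval_le {f : ℕ → E} {z : 𝕜} (hz : ‖z‖ ≤ 1) {C : ℝ} (hC : 0 ≤ C)
    (hf : ∀ᶠ n in atTop, ‖f n‖ ≤ C * ‖z ^ n‖) (d : ℕ) :
    ∀ᶠ n in atTop, ∀ p : 𝕜[X], p.degree ≤ d →
      ‖shiftEval p f n‖ ≤ C * coeffNorm d p * ‖z‖ ^ n := by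
  obtain ⟨N, hN⟩ := eventually_atTop.1 hf
  filter_upwards [eventually_ge_atTop N] with n hn p hp
  rw [shiftEval_eq_sum_range hp, coeffNorm, Finset.mul_sum, Finset.sum_mul]
  refine norm_sum_le_of_le _ fun j _ => ?_
  have h1 : ‖f (n + j)‖ ≤ C * ‖z‖ ^ (n + j) := by simpa using hN (n + j) (by omega)
  have h2 : C * ‖z‖ ^ (n + j) ≤ C * ‖z‖ ^ n :=
    mul_le_mul_of_nonneg_left
      (pow_le_pow_of_le_one (norm_nonneg z) hz (Nat.le_add_right n j)) hC
  rw [norm_smul]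
  calc ‖p.coeff j‖ * ‖f (n + j)‖ ≤ ‖p.coeff j‖ * (C * ‖z‖ ^ n) := by gcongr; exact h1.trans h2
    _ = C * ‖p.coeff j‖ * ‖z‖ ^ n := by ring

theorem isBigO_shiftEval {f : ℕ → E} {z : 𝕜} (hz : ‖z‖ ≤ 1)
    (hf : f =O[atTop] fun n => z ^ n) (p : 𝕜[X]) :
    shiftEval p f =O[atTop] fun n => z ^ n := by
  obtain ⟨C, hC0, hC⟩ := hf.exists_pos
  refine IsBigO.of_bound (C * coeffNorm p.natDegree p) ?_
  filter_upwards [eventually_norm_shiftEval_le hz hC0.le hC.bound p.natDegree] with n hn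
  simpa using hn p degree_le_natDegree

theorem isLittleO_shiftEval {f : ℕ → E} {z : 𝕜} (hz : ‖z‖ ≤ 1)
    (hf : f =o[atTop] fun n => z ^ n) (p : 𝕜[X]) :
    shiftEval p f =o[atTop] fun n => z ^ n := by
  refine isLittleO_iff.2 fun c hc => ?_
  have hp : 0 < coeffNorm p.natDegree p + 1 := by
    have := coeffNorm_nonneg p.natDegree p; positivity
  have h := eventually_norm_shiftEval_le hz (div_pos hc hp).le
    (isLittleO_iff.1 hf (div_pos hc hp)) p.natDegree
  filter_upwards [h] with n hn
  refine (hn p degree_le_natDegree).trans ?_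
  rw [norm_pow]
  refine mul_le_mul_of_nonneg_right ?_ (by positivity)
  rw [div_mul_eq_mul_div, div_le_iff₀ hp]
  exact mul_le_mul_of_nonneg_left (by linarith) hc.le

/-- The action on a sum of exponentials with a remainder. -/
theorem shiftEval_eq_add_sum (p : 𝕜[X]) (Λ : ℕ → 𝕜) (v : ℕ → E) (f : ℕ → E) (k n : ℕ) :
    shiftEval p f n = shiftEval p (fun i => f i - ∑ l ∈ Finset.range k, Λ l ^ i • v l) n +
      ∑ l ∈ Finset.range k, (Λ l ^ n * p.eval (Λ l)) • v l := by
  simp only [← shiftEval_pow_smul]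
  rw [← shiftEval_fun_sum, ← shiftEval_fun_add]
  simp

theorem IsAnnihilator.shiftEval_shiftEval_eq_zero {m : ℕ → 𝕜} {k n : ℕ} {P : 𝕜[X]}
    (hP : IsAnnihilator m k n P) {q : 𝕜[X]} (hq : q.degree < k) :
    shiftEval q (shiftEval P m) n = 0 := by
  rcases k with _ | k
  · rw [show q = 0 by simpa using hq, shiftEval_zero]
  · rw [shiftEval_eq_sum_range (degree_le_of_lt_succ hq)]
    exact Finset.sum_eq_zero fun j hj => by rw [hP.2 j (Finset.mem_range.1 hj), smul_zero]

end Estimates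

/-! ### Annihilators of sums of exponentials -/

section Nodes

variable {𝕜 : Type*} [NormedField 𝕜] {Λ : ℕ → 𝕜}

theorem eval_prod_X_sub_C_ne_zero {ι : Type*} {t : Finset ι} {v : ι → 𝕜} {z : 𝕜}
    (h : ∀ j ∈ t, z ≠ v j) : (∏ j ∈ t, (X - C (v j))).eval z ≠ 0 := by
  rw [eval_prod]
  exact Finset.prod_ne_zero_iff.2 fun j hj => by simpa using sub_ne_zero.2 (h j hj)

theorem eval_prod_X_sub_C_eq_zero {ι : Type*} {t : Finset ι} {v : ι → 𝕜} {j : ι}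
    (hj : j ∈ t) : (∏ j ∈ t, (X - C (v j))).eval (v j) = 0 := by
  rw [eval_prod]
  exact Finset.prod_eq_zero hj (by simp)

theorem degree_prod_X_sub_C {ι : Type*} (t : Finset ι) (v : ι → 𝕜) :
    (∏ j ∈ t, (X - C (v j))).degree = (t.card : WithBot ℕ) := by
  rw [degree_prod]
  simp [degree_X_sub_C]

theorem ne_of_strictAnti_norm (hanti : StrictAnti fun i => ‖Λ i‖) (hone : ‖Λ 0‖ < 1) (l : ℕ) :
    (1 : 𝕜) ≠ Λ l := fun h => by
  have : ‖Λ l‖ ≤ ‖Λ 0‖ := hanti.antitone (Nat.zero_le l)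
  rw [← h, norm_one] at this
  exact absurd hone this.not_gt

/-- An annihilator is small at the nodes. The remaining nodes are cancelled by the polynomial
vanishing at them, which has degree less than `k` and so preserves the annihilation at `n`. -/
theorem eventually_norm_eval_mul_le (hanti : StrictAnti fun i => ‖Λ i‖) (hone : ‖Λ 0‖ < 1)
    {m : ℕ → 𝕜} {b : ℕ → 𝕜} {k l : ℕ} (hl : l < k) (hb : b l ≠ 0)
    (hm : (fun n => m n - ∑ j ∈ Finset.range k, Λ j ^ n • b j) =O[atTop] fun n => Λ k ^ n) :
    ∃ C, 0 < C ∧ ∀ᶠ n in atTop, ∀ P, IsAnnihilator m k n P →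
      ‖P.eval (Λ l)‖ * ‖Λ l‖ ^ n ≤ C * coeffNorm k P * ‖Λ k‖ ^ n := by
  have hinj : Function.Injective Λ := fun i j h => hanti.injective (congrArg norm h)
  have hk1 : ‖Λ k‖ ≤ 1 := (hanti.antitone (Nat.zero_le k)).trans hone.le
  set q : 𝕜[X] := ∏ j ∈ (Finset.range k).erase l, (X - C (Λ j)) with hq
  have hlk : l ∈ Finset.range k := Finset.mem_range.2 hl
  have hqd : q.degree < k := by
    rw [degree_prod_X_sub_C, Finset.card_erase_of_mem hlk, Finset.card_range]
    exact_mod_cast (by omega : k - 1 < k)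
  set w := q.eval (Λ l) * b l with hw
  have hw0 : 0 < ‖w‖ := norm_pos_iff.2 <| mul_ne_zero
    (eval_prod_X_sub_C_ne_zero fun j hj => hinj.ne (Finset.ne_of_mem_erase hj).symm) hb
  set r := shiftEval q fun n => m n - ∑ j ∈ Finset.range k, Λ j ^ n • b j with hr
  have hqm : shiftEval q m = fun i => r i + Λ l ^ i • w := by
    funext i
    rw [shiftEval_eq_add_sum q Λ b m k i, Finset.sum_eq_single_of_mem l hlk, hw, smul_eq_mul,
      smul_eq_mul, mul_assoc]
    intro j hj hne
    rw [hq, eval_prod_X_sub_C_eq_zero (Finset.mem_erase.2 ⟨hne, hj⟩), mul_zero, zero_smul]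
  obtain ⟨C, hC, hbound⟩ := (isBigO_shiftEval hk1 hm q).exists_pos
  refine ⟨C / ‖w‖, by positivity, ?_⟩
  filter_upwards [eventually_norm_shiftEval_le hk1 hC.le hbound.bound k] with n hn P hP
  have h0 := hP.shiftEval_shiftEval_eq_zero hqd
  rw [shiftEval_comm, hqm, shiftEval_fun_add, shiftEval_pow_smul, add_comm] at h0
  have h1 := hn P hP.1
  rw [← norm_neg, ← eq_neg_of_add_eq_zero_left h0, smul_eq_mul, norm_mul, norm_mul,
    norm_pow] at h1
  rw [div_mul_eq_mul_div, div_mul_eq_mul_div, le_div_iff₀ hw0]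
  linarith

theorem eventually_norm_eval_le (hanti : StrictAnti fun i => ‖Λ i‖) (hone : ‖Λ 0‖ < 1)
    {m : ℕ → 𝕜} {b : ℕ → 𝕜} {k l : ℕ} (hl : l < k) (hb : b l ≠ 0)
    (hm : (fun n => m n - ∑ j ∈ Finset.range k, Λ j ^ n • b j) =O[atTop] fun n => Λ k ^ n)
    {ε : ℝ} (hε : 0 < ε) :
    ∀ᶠ n in atTop, ∀ P, IsAnnihilator m k n P → ‖P.eval (Λ l)‖ ≤ ε * coeffNorm k P := by
  obtain ⟨C, hC, h⟩ := eventually_norm_eval_mul_le hanti hone hl hb hm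
  have hlt : ‖Λ k‖ < ‖Λ l‖ := hanti hl
  have hpos : 0 < ‖Λ l‖ := (norm_nonneg _).trans_lt hlt
  have hlim := (tendsto_pow_atTop_nhds_zero_of_lt_one (div_nonneg (norm_nonneg (Λ k)) hpos.le)
    ((div_lt_one hpos).2 hlt)).const_mul C
  rw [mul_zero] at hlim
  filter_upwards [h, hlim.eventually_lt_const hε] with n hn hεn P hP
  have h1 := hn P hP
  rw [div_pow, mul_div_assoc', div_lt_iff₀ (by positivity)] at hεn
  refine le_of_mul_le_mul_right (h1.trans ?_) (pow_pos hpos n)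
  have := mul_le_mul_of_nonneg_right hεn.le (coeffNorm_nonneg k P)
  linarith

theorem exists_coeffNorm_le_eval {k : ℕ} (hinj : Function.Injective Λ) {z : 𝕜}
    (hz : ∀ l < k, z ≠ Λ l) :
    ∃ M, 0 < M ∧ ∀ P : 𝕜[X], P.degree ≤ k →
      coeffNorm k P ≤ M * (‖P.eval z‖ + ∑ l ∈ Finset.range k, ‖P.eval (Λ l)‖) := by
  set v : ℕ → 𝕜 := fun i => if i < k then Λ i else z with hv
  have hvinj : Set.InjOn v (Finset.range (k + 1) : Set ℕ) := by
    intro i hi j hj hij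
    simp only [Finset.coe_range, Set.mem_Iio] at hi hj
    simp only [hv] at hij
    split_ifs at hij with h1 h2 h2
    · exact hinj hij
    · exact absurd hij.symm (hz i h1)
    · exact absurd hij (hz j h2)
    · omega
  set B : ℕ → 𝕜[X] := Lagrange.basis (Finset.range (k + 1)) v with hB
  set M := ∑ i ∈ Finset.range (k + 1), coeffNorm k (B i) with hM
  have hM0 : 0 ≤ M := Finset.sum_nonneg fun _ _ => coeffNorm_nonneg _ _
  refine ⟨M + 1, by positivity, fun P hP => ?_⟩
  have hsum : ∑ i ∈ Finset.range (k + 1), ‖P.eval (v i)‖ =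
      ‖P.eval z‖ + ∑ l ∈ Finset.range k, ‖P.eval (Λ l)‖ := by
    rw [Finset.sum_range_succ, add_comm]
    congr 1
    · simp [hv]
    · exact Finset.sum_congr rfl fun i hi => by simp [hv, Finset.mem_range.1 hi]
  rw [← hsum]
  have hPe : P = ∑ i ∈ Finset.range (k + 1), C (P.eval (v i)) * B i := by
    rw [hB, ← Lagrange.interpolate_apply]
    refine Lagrange.eq_interpolate hvinj ?_
    rw [Finset.card_range]
    exact hP.trans_lt (by exact_mod_cast Nat.lt_succ_self k)
  have hle : coeffNorm k P ≤ ∑ i ∈ Finset.range (k + 1), ‖P.eval (v i)‖ * coeffNorm k (B i) := by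
    simp only [coeffNorm, Finset.mul_sum]
    rw [Finset.sum_comm]
    refine Finset.sum_le_sum fun j _ => ?_
    conv_lhs => rw [hPe]
    rw [finsetSum_coeff]
    exact norm_sum_le_of_le _ fun i _ => by rw [coeff_C_mul, norm_mul]
  refine hle.trans ?_
  rw [Finset.mul_sum]
  refine Finset.sum_le_sum fun i hi => ?_
  rw [mul_comm]
  refine mul_le_mul_of_nonneg_right ?_ (norm_nonneg _)
  have : coeffNorm k (B i) ≤ M :=
    Finset.single_le_sum (f := fun i => coeffNorm k (B i)) (fun _ _ => coeffNorm_nonneg _ _) hi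
  linarith

/-- An annihilator is controlled by its value at any point other than the nodes, since it is
small at the nodes and determined by its values at `k + 1` points. -/
theorem eventually_coeffNorm_le (hanti : StrictAnti fun i => ‖Λ i‖) (hone : ‖Λ 0‖ < 1)
    {m : ℕ → 𝕜} {b : ℕ → 𝕜} {k : ℕ} (hb : ∀ l < k, b l ≠ 0)
    (hm : (fun n => m n - ∑ j ∈ Finset.range k, Λ j ^ n • b j) =O[atTop] fun n => Λ k ^ n)
    {z : 𝕜} (hz : ∀ l < k, z ≠ Λ l) :
    ∃ M, 0 < M ∧ ∀ᶠ n in atTop, ∀ P, IsAnnihilator m k n P → coeffNorm k P ≤ M * ‖P.eval z‖ := by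
  have hinj : Function.Injective Λ := fun i j h => hanti.injective (congrArg norm h)
  obtain ⟨M, hM, hMP⟩ := exists_coeffNorm_le_eval hinj hz
  set ε := (2 * M * (k + 1))⁻¹ with hε
  have hε0 : 0 < ε := by positivity
  have hall : ∀ᶠ n in atTop, ∀ l ∈ Finset.range k, ∀ P, IsAnnihilator m k n P →
      ‖P.eval (Λ l)‖ ≤ ε * coeffNorm k P :=
    (eventually_all_finset _).2 fun l hl => eventually_norm_eval_le hanti hone
      (Finset.mem_range.1 hl) (hb l (Finset.mem_range.1 hl)) hm hε0
  refine ⟨2 * M, by positivity, ?_⟩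
  filter_upwards [hall] with n hn P hP
  have h1 := hMP P hP.1
  have h2 : ∑ l ∈ Finset.range k, ‖P.eval (Λ l)‖ ≤ k * (ε * coeffNorm k P) := by
    simpa using Finset.sum_le_card_nsmul (Finset.range k) _ _ fun l hl => hn l hl P hP
  have h3 : M * (k * (ε * coeffNorm k P)) ≤ coeffNorm k P / 2 := by
    have h4 : M * (k * ε) ≤ 1 / 2 := by
      rw [hε, ← div_eq_mul_inv, mul_div_assoc', div_le_iff₀ (by positivity)]
      linarith
    have := mul_le_mul_of_nonneg_right h4 (coeffNorm_nonneg k P)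
    linarith
  have := mul_le_mul_of_nonneg_left h2 hM.le
  linarith

theorem eventually_isRegularAt (hanti : StrictAnti fun i => ‖Λ i‖) (hone : ‖Λ 0‖ < 1)
    {m : ℕ → 𝕜} {b : ℕ → 𝕜} {k : ℕ} (hb : ∀ l < k, b l ≠ 0)
    (hm : (fun n => m n - ∑ j ∈ Finset.range k, Λ j ^ n • b j) =O[atTop] fun n => Λ k ^ n) :
    ∀ᶠ n in atTop, IsRegularAt m k n := by
  have h0 : ∀ l < k, (0 : 𝕜) ≠ Λ l := fun l hl h => by
    have : ‖Λ k‖ < ‖Λ l‖ := hanti hl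
    rw [← h, norm_zero] at this
    exact absurd this (norm_nonneg _).not_gt
  obtain ⟨M₀, -, hM₀⟩ := eventually_coeffNorm_le hanti hone hb hm h0
  obtain ⟨M₁, -, hM₁⟩ := eventually_coeffNorm_le hanti hone hb hm
    fun l _ => ne_of_strictAnti_norm hanti hone l
  filter_upwards [hM₀, hM₁] with n hn₀ hn₁ P hP hval
  refine eq_zero_of_coeffNorm_nonpos hP.1 ?_
  rcases hval with h | h
  · simpa [h] using hn₀ P hP
  · simpa [h] using hn₁ P hP

end Nodes

/-! ### The error of the even entries -/

section Error

variable {𝕜 E : Type*} [NontriviallyNormedField 𝕜] [NormedAddCommGroup E] [NormedSpace 𝕜 E]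
  {Λ : ℕ → 𝕜} {a : ℕ → 𝕜} {u : ℕ → E} {s : ℕ → E} {S : E}

theorem HasAsymptoticExpansion.isLittleO
    (hs : HasAsymptoticExpansion (fun n => s n - S) (fun i n => Λ i ^ n) a u) (k : ℕ) :
    (fun n => (s n - S) - ∑ l ∈ Finset.range (k + 1), Λ l ^ n • (a l • u l))
      =o[atTop] fun n => Λ k ^ n := by
  refine (hs k).congr_left fun n => ?_
  congr 1
  exact Finset.sum_congr rfl fun l _ => by rw [smul_smul, mul_comm]

theorem HasAsymptoticExpansion.isBigO
    (hs : HasAsymptoticExpansion (fun n => s n - S) (fun i n => Λ i ^ n) a u) (k : ℕ) :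
    (fun n => (s n - S) - ∑ l ∈ Finset.range k, Λ l ^ n • (a l • u l))
      =O[atTop] fun n => Λ k ^ n := by
  have h2 : (fun n => Λ k ^ n • (a k • u k)) =O[atTop] fun n => Λ k ^ n :=
    IsBigO.of_bound ‖a k • u k‖ (Eventually.of_forall fun n => by rw [norm_smul, mul_comm])
  refine ((hs.isLittleO k).isBigO.add h2).congr_left fun n => ?_
  rw [Finset.sum_range_succ]
  abel

/-- The expansion is inherited by the image under a continuous functional. -/
theorem HasAsymptoticExpansion.map
    (hs : HasAsymptoticExpansion (fun n => s n - S) (fun i n => Λ i ^ n) a u) (y : E →L[𝕜] 𝕜) :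
    HasAsymptoticExpansion (fun n => y (s n) - y S) (fun i n => Λ i ^ n) a fun l => y (u l) := by
  intro p
  refine ((y.isBigO_comp _ _).trans_isLittleO (hs p)).congr_left fun n => ?_
  simp [map_sub, map_sum]

theorem HasAsymptoticExpansion.isBigO_difference (hanti : StrictAnti fun i => ‖Λ i‖)
    (hone : ‖Λ 0‖ < 1)
    (hs : HasAsymptoticExpansion (fun n => s n - S) (fun i n => Λ i ^ n) a u) (y : E →L[𝕜] 𝕜)
    (k : ℕ) :
    (fun n => y (s (n + 1) - s n) -
        ∑ l ∈ Finset.range k, Λ l ^ n • ((Λ l - 1) * (a l * y (u l))))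
      =O[atTop] fun n => Λ k ^ n := by
  have hk1 : ‖Λ k‖ ≤ 1 := (hanti.antitone (Nat.zero_le k)).trans hone.le
  refine (isBigO_shiftEval hk1 ((hs.map y).isBigO k) (X - 1)).congr_left fun n => ?_
  have h := shiftEval_eq_add_sum (X - 1 : 𝕜[X]) Λ (fun l => a l • y (u l))
    (fun n => y (s n) - y S) k n
  rw [shiftEval_X_sub_one] at h
  rw [eq_sub_of_add_eq h.symm]
  congr 1
  · simp
  · refine Finset.sum_congr rfl fun l _ => ?_
    simp only [eval_sub, eval_X, eval_one, smul_eq_mul]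
    ring

theorem shiftEval_sub_const {P : 𝕜[X]} (hP1 : P.eval 1 = 1) (n : ℕ) :
    shiftEval P s n - S = shiftEval P (fun i => s i - S) n := by
  have h := shiftEval_fun_add P (fun i => s i - S) (fun _ => S) n
  rw [shiftEval_const, hP1, one_smul] at h
  simp only [sub_add_cancel] at h
  rw [h, add_sub_cancel_right]

theorem coeff_difference_ne_zero (hanti : StrictAnti fun i => ‖Λ i‖) (hone : ‖Λ 0‖ < 1)
    {y : E →L[𝕜] 𝕜} {l : ℕ} (h : a l ≠ 0 ∧ y (u l) ≠ 0) :
    (Λ l - 1) * (a l * y (u l)) ≠ 0 :=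
  mul_ne_zero (sub_ne_zero.2 (ne_of_strictAnti_norm hanti hone l).symm) (mul_ne_zero h.1 h.2)

/-- The error of a normalised annihilator: each of the first `k` exponentials is multiplied by the
value at its node, which is small enough to bring it down to the order of the next one. -/
theorem exists_norm_shiftEval_sub_le (hanti : StrictAnti fun i => ‖Λ i‖) (hone : ‖Λ 0‖ < 1)
    (hs : HasAsymptoticExpansion (fun n => s n - S) (fun i n => Λ i ^ n) a u) (y : E →L[𝕜] 𝕜)
    {k : ℕ} (hk : ∀ i < k, a i ≠ 0 ∧ y (u i) ≠ 0) :
    ∃ C, ∀ᶠ n in atTop, ∀ P, IsAnnihilator (fun n => y (s (n + 1) - s n)) k n P →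
      P.eval 1 = 1 → ‖shiftEval P s n - S‖ ≤ C * ‖Λ k‖ ^ n := by
  have hk1 : ‖Λ k‖ ≤ 1 := (hanti.antitone (Nat.zero_le k)).trans hone.le
  have hm := hs.isBigO_difference hanti hone y k
  have hb := fun l hl => coeff_difference_ne_zero hanti hone (hk l hl)
  obtain ⟨M, hM, hcoeff⟩ := eventually_coeffNorm_le hanti hone hb hm
    (fun l _ => ne_of_strictAnti_norm hanti hone l)
  have hnode : ∀ l, ∃ C, 0 < C ∧ (l < k → ∀ᶠ n in atTop, ∀ P,
      IsAnnihilator (fun n => y (s (n + 1) - s n)) k n P →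
      ‖P.eval (Λ l)‖ * ‖Λ l‖ ^ n ≤ C * coeffNorm k P * ‖Λ k‖ ^ n) := by
    intro l
    by_cases hl : l < k
    · obtain ⟨C, hC, h⟩ := eventually_norm_eval_mul_le hanti hone hl (hb l hl) hm
      exact ⟨C, hC, fun _ => h⟩
    · exact ⟨1, one_pos, fun h => absurd h hl⟩
  choose B hB hnode using hnode
  obtain ⟨C, hC, hbound⟩ := (hs.isBigO k).exists_pos
  refine ⟨C * M + ∑ l ∈ Finset.range k, B l * M * ‖a l • u l‖, ?_⟩
  filter_upwards [hcoeff, eventually_norm_shiftEval_le hk1 hC.le hbound.bound k,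
    (eventually_all_finset (Finset.range k)).2 fun l hl => hnode l (Finset.mem_range.1 hl)]
    with n h1 h2 h3 P hP hP1
  have hPM : coeffNorm k P ≤ M := by simpa [hP1] using h1 P hP
  rw [shiftEval_sub_const hP1, shiftEval_eq_add_sum P Λ (fun l => a l • u l) _ k n, add_mul,
    Finset.sum_mul]
  refine norm_add_le_of_le ((h2 P hP.1).trans ?_) (norm_sum_le_of_le _ fun l hl => ?_)
  · gcongr
  · have h4 : ‖P.eval (Λ l)‖ * ‖Λ l‖ ^ n ≤ B l * M * ‖Λ k‖ ^ n :=
      (h3 l hl P hP).trans (by have := hB l; gcongr)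
    rw [norm_smul, norm_mul, norm_pow]
    have := mul_le_mul_of_nonneg_right h4 (norm_nonneg (a l • u l))
    linarith

/-- The functional `y` of the error is exactly of order `Λ k ^ n`. Multiplying `P` by
`q = ∏ l < k, (X - Λ l)` changes the error only by the factor `q 1`, because `P` is an annihilator
and `q` has degree `k`; and `q` removes the first `k` exponentials. -/
theorem exists_le_norm_shiftEval_sub (hanti : StrictAnti fun i => ‖Λ i‖) (hone : ‖Λ 0‖ < 1)
    (hs : HasAsymptoticExpansion (fun n => s n - S) (fun i n => Λ i ^ n) a u) (y : E →L[𝕜] 𝕜)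
    {k : ℕ} (hk : ∀ i ≤ k, a i ≠ 0 ∧ y (u i) ≠ 0) :
    ∃ c, 0 < c ∧ ∀ᶠ n in atTop, ∀ P, IsAnnihilator (fun n => y (s (n + 1) - s n)) k n P →
      P.eval 1 = 1 → c * ‖Λ k‖ ^ n ≤ ‖shiftEval P s n - S‖ := by
  have hinj : Function.Injective Λ := fun i j h => hanti.injective (congrArg norm h)
  have hk1 : ‖Λ k‖ ≤ 1 := (hanti.antitone (Nat.zero_le k)).trans hone.le
  have hm := hs.isBigO_difference hanti hone y k
  have hb := fun l (hl : l < k) => coeff_difference_ne_zero hanti hone (hk l hl.le)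
  obtain ⟨M, hM, hcoeff⟩ := eventually_coeffNorm_le hanti hone hb hm
    (z := Λ k) (fun l hl => hinj.ne hl.ne')
  set q : 𝕜[X] := ∏ l ∈ Finset.range k, (X - C (Λ l)) with hq
  have hq1 : 0 < ‖q.eval 1‖ := norm_pos_iff.2 <|
    eval_prod_X_sub_C_ne_zero fun l _ => ne_of_strictAnti_norm hanti hone l
  set w := q.eval (Λ k) * (a k * y (u k)) with hw
  have hw0 : 0 < ‖w‖ := norm_pos_iff.2 <| mul_ne_zero
    (eval_prod_X_sub_C_ne_zero fun l hl => hinj.ne (Finset.mem_range.1 hl).ne')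
    (mul_ne_zero (hk k le_rfl).1 (hk k le_rfl).2)
  obtain ⟨r, hr⟩ : (X - 1) ∣ q - C (q.eval 1) := by
    have : (X - C 1) ∣ q - C (q.eval 1) := by rw [dvd_iff_isRoot]; simp
    simpa using this
  have hrd : r.degree < k := by
    rcases eq_or_ne r 0 with rfl | hr0
    · simp
    · have h1 : (X - 1 : 𝕜[X]).degree = 1 := by simpa using degree_X_sub_C (1 : 𝕜)
      have h2 : (q - C (q.eval 1)).degree ≤ (k : WithBot ℕ) := by
        refine (degree_sub_le _ _).trans (max_le ?_ (degree_C_le.trans ?_))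
        · rw [hq, degree_prod_X_sub_C, Finset.card_range]
        · exact_mod_cast Nat.zero_le k
      rw [hr, degree_mul, h1, degree_eq_natDegree hr0] at h2
      rw [degree_eq_natDegree hr0]
      have h3 : 1 + r.natDegree ≤ k := by exact_mod_cast h2
      exact_mod_cast (by omega : r.natDegree < k)
  set t : ℕ → 𝕜 := fun n => y (s n) - y S with ht
  set ρ := shiftEval q fun n => t n - ∑ l ∈ Finset.range (k + 1), Λ l ^ n • (a l • y (u l)) with hρ
  have hqt : shiftEval q t = fun i => ρ i + Λ k ^ i • w := by
    funext i
    rw [shiftEval_eq_add_sum q Λ (fun l => a l • y (u l)) t (k + 1) i, Finset.sum_range_succ,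
      Finset.sum_eq_zero, zero_add, hw, smul_eq_mul, smul_eq_mul, smul_eq_mul, mul_assoc]
    intro l hl
    rw [hq, eval_prod_X_sub_C_eq_zero hl, mul_zero, zero_smul]
  have hρo : ρ =o[atTop] fun n => Λ k ^ n :=
    isLittleO_shiftEval hk1 ((hs.map y).isLittleO k) q
  set δ := ‖w‖ / (2 * M) with hδ
  have hδ0 : 0 < δ := by positivity
  refine ⟨δ / (‖q.eval 1‖ * (‖y‖ + 1)), by positivity, ?_⟩
  filter_upwards [hcoeff, eventually_norm_shiftEval_le hk1 hδ0.le (isLittleO_iff.1 hρo hδ0) k]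
    with n h1 h2 P hP hP1
  have hP1' : 1 ≤ coeffNorm k P := by simpa [hP1] using norm_eval_one_le_coeffNorm hP.1
  have hmt : (fun n => y (s (n + 1) - s n)) = shiftEval (X - 1 : 𝕜[X]) t := by
    funext i; rw [shiftEval_X_sub_one, ht]; simp
  have hyt : y (shiftEval P s n - S) = shiftEval P t n := by
    rw [shiftEval_sub_const hP1]
    simpa [ht] using shiftEval_map (y : E →ₗ[𝕜] 𝕜) P (fun i => s i - S) n
  have hmul : q.eval 1 * shiftEval P t n = shiftEval P ρ n + Λ k ^ n * P.eval (Λ k) * w := by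
    have h3 := hP.shiftEval_shiftEval_eq_zero hrd
    rw [hmt, shiftEval_comm P, ← shiftEval_mul r, mul_comm r, ← hr, shiftEval_sub,
      ← mul_one (C (q.eval 1)), shiftEval_C_mul, shiftEval_one, shiftEval_comm, hqt,
      shiftEval_fun_add, shiftEval_pow_smul, smul_eq_mul, smul_eq_mul] at h3
    linear_combination -h3
  have h4 : ‖Λ k ^ n * P.eval (Λ k) * w‖ ≤
      ‖q.eval 1 * shiftEval P t n‖ + ‖shiftEval P ρ n‖ := by
    rw [← sub_eq_of_eq_add' hmul]
    exact norm_sub_le _ _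
  rw [norm_mul _ w, norm_mul (Λ k ^ n), norm_pow, norm_mul (q.eval 1)] at h4
  have h5 : ‖shiftEval P t n‖ ≤ (‖y‖ + 1) * ‖shiftEval P s n - S‖ := by
    rw [← hyt]
    refine (y.le_opNorm _).trans ?_
    gcongr
    linarith
  have h6 : 2 * δ * coeffNorm k P ≤ ‖P.eval (Λ k)‖ * ‖w‖ := by
    have : 2 * δ * coeffNorm k P = coeffNorm k P / M * ‖w‖ := by rw [hδ]; field_simp
    rw [this]
    gcongr
    rw [div_le_iff₀' hM]
    exact h1 P hP
  have h7 := mul_le_mul_of_nonneg_left h6 (pow_nonneg (norm_nonneg (Λ k)) n)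
  have h8 := mul_le_mul_of_nonneg_left h5 hq1.le
  have h9 : δ * ‖Λ k‖ ^ n ≤ δ * coeffNorm k P * ‖Λ k‖ ^ n := by
    gcongr
    exact le_mul_of_one_le_right hδ0.le hP1'
  rw [div_mul_eq_mul_div, div_le_iff₀ (by positivity)]
  linarith [h2 P hP.1]

/-- For all large `n` the first `k` steps are defined and lead to a normalised annihilator. -/
theorem eventually_tea1 (hanti : StrictAnti fun i => ‖Λ i‖) (hone : ‖Λ 0‖ < 1)
    (hs : HasAsymptoticExpansion (fun n => s n - S) (fun i n => Λ i ^ n) a u) (y : E →L[𝕜] 𝕜)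
    {k : ℕ} (hk : ∀ i < k, a i ≠ 0 ∧ y (u i) ≠ 0) :
    ∀ᶠ n in atTop, (∀ j < k, TEA1Step (y : Module.Dual 𝕜 E) s j n) ∧
      ∀ j ≤ k, ∃ P, IsAnnihilator (fun n => y (s (n + 1) - s n)) j n P ∧ P.eval 1 = 1 ∧
        epsHatEven (y : Module.Dual 𝕜 E) s j n = shiftEval P s n := by
  have hreg : ∀ᶠ n in atTop, ∀ j ∈ Finset.range (k + 1),
      IsRegularAt (fun n => y (s (n + 1) - s n)) j n :=
    (eventually_all_finset _).2 fun j hj => eventually_isRegularAt hanti hone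
      (fun l hl => coeff_difference_ne_zero hanti hone
        (hk l (hl.trans_le (Nat.lt_succ_iff.1 (Finset.mem_range.1 hj)))))
      (hs.isBigO_difference hanti hone y j)
  obtain ⟨N, hN⟩ := eventually_atTop.1 hreg
  filter_upwards [eventually_ge_atTop (N + 1)] with n hn
  have h := tea1Columns_eq (y : Module.Dual 𝕜 E) s (N := N) (k := k)
    fun j hj n hn => hN n hn j (Finset.mem_range.2 (by omega))
  exact ⟨(h k le_rfl n hn).1, fun j hj => (h j hj n hn).2.1⟩

/-- The convergence theorem for nodes in any nontrivially normed field. The alternating case is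
the one with nodes `-lam i`. -/
theorem tea1_convergence (hanti : StrictAnti fun i => ‖Λ i‖) (hone : ‖Λ 0‖ < 1)
    (hs : HasAsymptoticExpansion (fun n => s n - S) (fun i n => Λ i ^ n) a u) (y : E →L[𝕜] 𝕜)
    (k : ℕ) (hk : ∀ i < k, a i ≠ 0 ∧ y (u i) ≠ 0) :
    (∀ᶠ n in atTop, ∀ j < k, TEA1Step (y : Module.Dual 𝕜 E) s j n) ∧
    (fun n => epsHatEven (y : Module.Dual 𝕜 E) s k n - S) =O[atTop] (fun n => ‖Λ k‖ ^ n) ∧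
    (a k ≠ 0 ∧ y (u k) ≠ 0 →
      (∀ᶠ n in atTop, TEA1Step (y : Module.Dual 𝕜 E) s k n ∧
        epsHatEven (y : Module.Dual 𝕜 E) s k n ≠ S) ∧
      (fun n => ‖epsHatEven (y : Module.Dual 𝕜 E) s (k + 1) n - S‖ /
          ‖epsHatEven (y : Module.Dual 𝕜 E) s k n - S‖)
        =O[atTop] (fun n => (‖Λ (k + 1)‖ / ‖Λ k‖) ^ n)) := by
  have hstep := eventually_tea1 hanti hone hs y hk
  obtain ⟨C, hC⟩ := exists_norm_shiftEval_sub_le hanti hone hs y hk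
  refine ⟨hstep.mono fun n h => h.1, IsBigO.of_bound C ?_, fun hak => ?_⟩
  · filter_upwards [hstep, hC] with n h1 h2
    obtain ⟨P, hP, hP1, e⟩ := h1.2 k le_rfl
    rw [e, norm_pow, norm_norm]
    exact h2 P hP hP1
  have hk' : ∀ i < k + 1, a i ≠ 0 ∧ y (u i) ≠ 0 := fun i hi =>
    (Nat.lt_succ_iff_lt_or_eq.1 hi).elim (hk i) fun h => h ▸ hak
  have hstep' := eventually_tea1 hanti hone hs y hk'
  obtain ⟨C', hC'⟩ := exists_norm_shiftEval_sub_le hanti hone hs y hk'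
  obtain ⟨c, hc, hlow⟩ := exists_le_norm_shiftEval_sub hanti hone hs y
    (k := k) fun i hi => hk' i (by omega)
  have hpos : 0 < ‖Λ k‖ := (norm_nonneg _).trans_lt (hanti (Nat.lt_succ_self k))
  have hlow' : ∀ᶠ n in atTop,
      c * ‖Λ k‖ ^ n ≤ ‖epsHatEven (y : Module.Dual 𝕜 E) s k n - S‖ := by
    filter_upwards [hstep, hlow] with n h1 h2
    obtain ⟨P, hP, hP1, e⟩ := h1.2 k le_rfl
    exact e ▸ h2 P hP hP1
  refine ⟨?_, IsBigO.of_bound (C' / c) ?_⟩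
  · filter_upwards [hstep', hlow'] with n h1 h2
    refine ⟨h1.1 k (Nat.lt_succ_self k), fun h => ?_⟩
    rw [h, sub_self, norm_zero] at h2
    exact absurd h2 (by positivity : 0 < c * ‖Λ k‖ ^ n).not_ge
  · filter_upwards [hstep', hC', hlow'] with n h1 h2 h3
    obtain ⟨P, hP, hP1, e⟩ := h1.2 (k + 1) le_rfl
    have h4 := h2 P hP hP1
    rw [← e] at h4
    rw [norm_div, norm_norm, norm_norm, norm_pow, norm_div, norm_norm, norm_norm, div_pow,
      div_mul_div_comm]
    exact div_le_div₀ ((norm_nonneg _).trans h4) h4 (by positivity) h3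

end Error

/-- Indices `i` of `a`, `lam`, `u` start at `0`, so `lam k` is the `(k+1)`-st of the numbers
`1 > lam 0 > lam 1 > ⋯ > 0`. -/
theorem mainTheorem5 {𝕜 E : Type*} [RCLike 𝕜] [NormedAddCommGroup E] [NormedSpace 𝕜 E]
    (y : E →L[𝕜] 𝕜) (s : ℕ → E) (S : E) (a : ℕ → 𝕜) (lam : ℕ → ℝ) (u : ℕ → E)
    (hlam_one : lam 0 < 1) (hlam_anti : StrictAnti lam) (hlam_pos : ∀ i, 0 < lam i)
    (hs : HasAsymptoticExpansion (fun n => s n - S) (fun i n => (lam i : 𝕜) ^ n) a u ∨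
      HasAsymptoticExpansion (fun n => s n - S) (fun i n => (-1) ^ n * (lam i : 𝕜) ^ n) a u)
    (k : ℕ) (hk : ∀ i < k, a i ≠ 0 ∧ y (u i) ≠ 0) :
    (∀ᶠ n in atTop, ∀ j < k, TEA1Step (y : Module.Dual 𝕜 E) s j n) ∧
    (fun n => epsHatEven (y : Module.Dual 𝕜 E) s k n - S) =O[atTop] (fun n => lam k ^ n) ∧
    (a k ≠ 0 ∧ y (u k) ≠ 0 →
      (∀ᶠ n in atTop, TEA1Step (y : Module.Dual 𝕜 E) s k n ∧
        epsHatEven (y : Module.Dual 𝕜 E) s k n ≠ S) ∧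
      (fun n => ‖epsHatEven (y : Module.Dual 𝕜 E) s (k + 1) n - S‖ /
          ‖epsHatEven (y : Module.Dual 𝕜 E) s k n - S‖)
        =O[atTop] (fun n => (lam (k + 1) / lam k) ^ n)) := by
  have habs : ∀ i, ‖(lam i : 𝕜)‖ = lam i := fun i => by
    rw [RCLike.norm_ofReal, abs_of_pos (hlam_pos i)]
  rcases hs with hs | hs
  · simpa only [habs] using tea1_convergence (Λ := fun i => (lam i : 𝕜))
      (by simpa only [habs] using hlam_anti) (by simpa only [habs] using hlam_one) hs y k hk
  · simp only [← mul_pow, neg_one_mul] at hs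
    simpa only [norm_neg, habs] using tea1_convergence (Λ := fun i => -(lam i : 𝕜))
      (by simpa only [norm_neg, habs] using hlam_anti)
      (by simpa only [norm_neg, habs] using hlam_one) hs y k hk
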